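/- Let $\mathcal X$ be a measurable space, let $B\ge 1$ and $n\ge 2B$ be integers, let $g:\mathcal X\to[0,1]$ be measurable, and let $P$ be a probability distribution on $\mathcal X\times[0,1]$ such that, for $(X,Y)\sim P$, the law of $g(X)$ is absolutely continuous with respect to Lebesgue measure. Let $\mathcal D_n=\{(X_i,Y_i)\}_{i=1}^n$ be drawn i.i.d. from $P$. Consider the original (Zadrozny–Elkan) histogram binning, that is, uniform-mass binning without sample splitting, which produces $h:\mathcal X\to[0,1]$ as follows. Let $S_{(1)}\le\dots\le S_{(n)}$ be the order statistics of the scores $g(X_1),\dots,g(X_n)$, let $Y_{(k)}$ be the label belonging to $S_{(k)}$, and put $S_{(0)}=0$, $S_{(n+1)}=1$, $A_b=\lceil b(n+1)/B\rceil$ for $0\le b\le B$. For $1\le b\le B$, with $l=A_{b-1}$ and $u=A_b$, let \[ \widehat\Pi_b=\begin{cases}\operatorname{Mean}(Y_{(l+1)},\dots,Y_{(u-1)},Y_{(u)}), & b<B,\\ \operatorname{Mean}(Y_{(l+1)},\dots,Y_{(u-1)}), & b=B,\end{cases} \qquad h(x)=\sum_{b=1}^B \mathbf 1\{S_{(A_{b-1})}\le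 g(x)<S_{(A_b)}\}\,\widehat\Pi_b . \] Let $\alpha\in(0,1)$ and \[ \varepsilon=\sqrt{\frac{\log(2B/\alpha)}{2(\lfloor n/B\rfloor-1)}}+\frac1{\lfloor n/B\rfloor}. \] Then this procedure is $(\varepsilon,\alpha)$-conditionally calibrated: with probability at least $1-\alpha$ over $\mathcal D_n$, \[ \bigl|\mathbb E[Y\mid h(X)=r]-r\bigr|\le\varepsilon\quad\text{for every } r\in\operatorname{Range}(h), \] where $(X,Y)\sim P$ is independent of $\mathcal D_n$, the expectation is over $(X,Y)$ with $h$ held fixed, and $r\mapsto\mathbb E[Y\mid h(X)=r]$ denotes a suitable version of the conditional expectation (its value is determined at every $r$ with $P(h(X)=r)>0$, and is irrelevant at other $r$). Moreover, with probability at least $1-\alpha$ over $\mathcal D_n$, simultaneously for all $p\in[1,\infty)$, \[ \ell_p\text{-ECE}(h):=\Bigl(\mathbb E_X\bigl|\mathbb E[Y\mid h(X)]-h(X)\bigr|^p\Bigr)^{1/p}\le\varepsilon . \] -/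

import Mathlib

open MeasureTheory ProbabilityTheory

noncomputable section

namespace HistogramBinning

/-- The class `𝒢` of all measurable functions `𝒳 → [0, 1]`. -/
abbrev Predictor (𝒳 : Type*) [MeasurableSpace 𝒳] : Type _ :=
  {g : 𝒳 → unitInterval // Measurable g}

/-- A calibration data set `(X₁, Y₁), …, (Xₙ, Yₙ)` with labels in `[0, 1]`. -/
abbrev Dataset (𝒳 : Type*) (n : ℕ) : Type _ := Fin n → 𝒳 × unitInterval

/-- A calibrator `H : 𝒢 × (𝒳 × [0, 1])ⁿ → 𝒢`. -/
abbrev Calibrator (𝒳 : Type*) [MeasurableSpace 𝒳] (n : ℕ) : Type _ :=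
  Predictor 𝒳 → Dataset 𝒳 n → Predictor 𝒳

section Calibration

variable {𝒳 : Type*} [MeasurableSpace 𝒳]

/-- The random variable `E[Y | h(X)]` for `(X, Y) ∼ P`, where `(X, Y)` is the coordinate pair. -/
def condMean (P : Measure (𝒳 × unitInterval)) (h : Predictor 𝒳) : 𝒳 × unitInterval → ℝ :=
  P[fun z => (z.2 : ℝ) | MeasurableSpace.comap (fun z : 𝒳 × unitInterval => h.1 z.1) inferInstance]

/-- `φ` is (a version of) the function `r ↦ E[Y | h(X) = r]`. At every `r` with
`P(h(X) = r) > 0` the value `φ r` is forced to be the elementary conditional expectation. -/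
def IsCondMeanFun (P : Measure (𝒳 × unitInterval)) (h : Predictor 𝒳)
    (φ : unitInterval → ℝ) : Prop :=
  Measurable φ ∧ (fun z : 𝒳 × unitInterval => φ (h.1 z.1)) =ᵐ[P] condMean P h

/-- `|E[Y | h(X) = r] - r| ≤ ε` for all `r ∈ Range h`. -/
def ApproxCalibrated (P : Measure (𝒳 × unitInterval)) (h : Predictor 𝒳) (ε : ℝ) : Prop :=
  ∃ φ : unitInterval → ℝ, IsCondMeanFun P h φ ∧ ∀ r ∈ Set.range h.1, |φ r - (r : ℝ)| ≤ ε

/-- The `ℓ_p` expected calibration error `(E_X |E[Y | h(X)] - h(X)|^p)^{1/p}`. -/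
def ece (P : Measure (𝒳 × unitInterval)) (h : Predictor 𝒳) (p : ℝ) : ℝ :=
  (∫ z, |condMean P h z - (h.1 z.1 : ℝ)| ^ p ∂P) ^ (1 / p)

/-- The property `A` of `n` independent draws from `P` holds with probability at least `1 - α`.
It is phrased through the failure event: for non-measurable `A` the (outer) bound on the failure
event is the stronger requirement. -/
def HoldsWithProb (P : Measure (𝒳 × unitInterval)) (n : ℕ) (α : ℝ)
    (A : Dataset 𝒳 n → Prop) : Prop :=
  Measure.pi (fun _ : Fin n => P) {D | ¬ A D} ≤ ENNReal.ofReal α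

/-- The requirement of `(ε, α)`-conditional calibration of `H` at the predictor `g` and the
distribution `P`. -/
def ConditionallyCalibratedAt {n : ℕ} (H : Calibrator 𝒳 n) (ε α : ℝ) (g : Predictor 𝒳)
    (P : Measure (𝒳 × unitInterval)) : Prop :=
  HoldsWithProb P n α fun D => ApproxCalibrated P (H g D) ε

end Calibration

section Algorithm

variable {n : ℕ}

/-- `S_(k)` for `0 ≤ k ≤ n + 1`, with `S_(0) = 0` and `S_(n+1) = 1`. -/
def orderStat (s : Fin n → unitInterval) (k : ℕ) : unitInterval :=
  if k = 0 then 0 else if hk : k - 1 < n then s (Tuple.sort s ⟨k - 1, hk⟩) else 1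

/-- `Y_(k)` for `1 ≤ k ≤ n`: the label that belongs to the `k`-th smallest score. -/
def orderedLabel (s y : Fin n → unitInterval) (k : ℕ) : unitInterval :=
  if hk : k - 1 < n then y (Tuple.sort s ⟨k - 1, hk⟩) else 0

/-- The boundary index `A_b = ⌈b (n + 1) / B⌉`. -/
def boundary (n B b : ℕ) : ℕ := ⌈(b : ℚ) * (((n : ℚ) + 1) / (B : ℚ))⌉₊

/-- The ranks of the points used to estimate the bias of bin `b ∈ {1, …, B}`, where
`l = A_{b-1}`, `u = A_b`: these are `l + 1, …, u` for `b < B` and `l + 1, …, u - 1` for `b = B`. -/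
def binRanks (n B b : ℕ) : Finset ℕ :=
  Finset.Ioc (boundary n B (b - 1)) (if b < B then boundary n B b else boundary n B b - 1)

/-- The bias estimate of bin `b`: the mean of the labels with ranks in `binRanks n B b`. -/
def biasEstimate (B : ℕ) (s y : Fin n → unitInterval) (b : ℕ) : ℝ :=
  (∑ k ∈ binRanks n B b, (orderedLabel s y k : ℝ)) / ((binRanks n B b).card : ℝ)

/-- The recalibrated score as a function of the original score `t`:
`∑_b 1{S_(A_{b-1}) ≤ t < S_(A_b)} Π̂_b`. -/
def binnedScore (B : ℕ) (s y : Fin n → unitInterval) (t : unitInterval) : ℝ :=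
  ∑ b ∈ Finset.Icc 1 B,
    if orderStat s (boundary n B (b - 1)) ≤ t ∧ t < orderStat s (boundary n B b)
      then biasEstimate B s y b else 0

theorem orderStat_mono (s : Fin n → unitInterval) : Monotone (orderStat s) := by
  intro i j hij
  unfold orderStat
  by_cases hi : i = 0
  · rw [if_pos hi]
    exact unitInterval.nonneg'
  have hj : j ≠ 0 := by omega
  rw [if_neg hi, if_neg hj]
  by_cases hjn : j - 1 < n
  · have hin : i - 1 < n := by omega
    rw [dif_pos hin, dif_pos hjn]
    exact Tuple.monotone_sort s (Fin.mk_le_mk.mpr (by omega))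
  · rw [dif_neg hjn]
    exact unitInterval.le_one'

theorem boundary_mono (n B : ℕ) : Monotone (boundary n B) := by
  intro i j hij
  unfold boundary
  gcongr

theorem biasEstimate_mem (B : ℕ) (s y : Fin n → unitInterval) (b : ℕ) :
    biasEstimate B s y b ∈ Set.Icc (0 : ℝ) 1 := by
  unfold biasEstimate
  constructor
  · exact div_nonneg (Finset.sum_nonneg fun k _ => (orderedLabel s y k).2.1) (Nat.cast_nonneg _)
  · refine div_le_one_of_le₀ ?_ (Nat.cast_nonneg _)
    calc ∑ k ∈ binRanks n B b, (orderedLabel s y k : ℝ)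
        ≤ ∑ _k ∈ binRanks n B b, (1 : ℝ) :=
          Finset.sum_le_sum fun k _ => (orderedLabel s y k).2.2
      _ = _ := by simp

theorem binnedScore_mem (B : ℕ) (s y : Fin n → unitInterval) (t : unitInterval) :
    binnedScore B s y t ∈ Set.Icc (0 : ℝ) 1 := by
  unfold binnedScore
  by_cases h : ∃ b ∈ Finset.Icc 1 B,
      orderStat s (boundary n B (b - 1)) ≤ t ∧ t < orderStat s (boundary n B b)
  · obtain ⟨b, hb, h1, h2⟩ := h
    rw [Finset.sum_eq_single_of_mem b hb, if_pos ⟨h1, h2⟩]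
    · exact biasEstimate_mem B s y b
    · intro c hc hcb
      apply if_neg
      rintro ⟨h3, h4⟩
      have hm := (orderStat_mono s).comp (boundary_mono n B)
      have hc1 := (Finset.mem_Icc.mp hc).1
      have hb1 := (Finset.mem_Icc.mp hb).1
      rcases lt_or_gt_of_ne hcb with hlt | hlt
      · have := hm (show c ≤ b - 1 by omega)
        exact absurd (h4.trans_le (this.trans h1)) (lt_irrefl _)
      · have := hm (show b ≤ c - 1 by omega)
        exact absurd (h2.trans_le (this.trans h3)) (lt_irrefl _)
  · push Not at h
    rw [Finset.sum_eq_zero]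
    · simp
    · intro b hb
      apply if_neg
      rintro ⟨h1, h2⟩
      exact absurd h2 (not_lt.mpr (h b hb h1))

theorem measurable_binnedScore (B : ℕ) (s y : Fin n → unitInterval) :
    Measurable (binnedScore B s y) := by
  unfold binnedScore
  refine Finset.measurable_sum _ fun b _ => ?_
  exact Measurable.ite (measurableSet_Ici.inter measurableSet_Iio)
    measurable_const measurable_const

/-- Histogram binning with `B` bins in its original form (uniform-mass binning without sample
splitting, the right boundary point of each bin but the last included in the bin mean). -/
def originalUMD {𝒳 : Type*} [MeasurableSpace 𝒳] (n B : ℕ) : Calibrator 𝒳 n := fun g D =>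
  ⟨fun x => ⟨binnedScore B (fun i => g.1 (D i).1) (fun i => (D i).2) (g.1 x),
      binnedScore_mem B _ _ _⟩,
    ((measurable_binnedScore B _ _).comp g.2).subtype_mk⟩

end Algorithm

end HistogramBinning

end

/-! Fix a bin with boundary ranks `l` and `u`. On the event that the points of ranks strictly
between `l` and `u` are those with indices in `T`, the boundary scores `S_(l)` and `S_(u)` are the
order statistics of ranks `l` and `l + 1` of the points outside `T`. Given the latter, the event
says that the points in `T` fall into the resulting cell, so under it they are i.i.d. draws from
`P` conditioned on that cell, and Hoeffding's inequality controls their mean label with no sample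
splitting. Summing over the disjoint events for all `T` gives the same tail bound unconditionally.
Including the right boundary point moves the mean of a bin by at most `1 / ⌊n / B⌋`, and a union
bound over the bins makes all estimates accurate simultaneously. Distinct bins may share the value
of `h`, so `E[Y | h(X)]` averages the bin means over such bins, and the tower property transfers
the estimate.
-/

namespace HistogramBinning

open scoped Finset

section KthSmallest

variable {κ β : Type*} [Fintype κ] [LinearOrder β]

theorem monotone_card_filter_le (s : κ → β) : Monotone fun v => #{m | s m ≤ v} := fun _ _ h =>
  Finset.card_le_card <| Finset.monotone_filter_right _ fun _ _ hm => hm.trans h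

theorem card_filter_le_eq_add [DecidableEq κ] (s : κ → β) (T : Finset κ) (v : β) :
    #{m | s m ≤ v} = #{m ∈ T | s m ≤ v} + #{i : {i // i ∉ T} | s i ≤ v} := by
  simp only [Finset.card_filter]
  rw [← Fintype.sum_subtype_add_sum_subtype (· ∈ T), Finset.sum_subtype T fun _ => Iff.rfl]

variable [BoundedOrder β]

/-- The `k`-th smallest of the values `s m`, counted with multiplicity; it is `⊥` for `k = 0` and
`⊤` when `k` exceeds the number of values, in accordance with `S_(0) = 0` and `S_(n+1) = 1`. -/
def kthSmallest (s : κ → β) (k : ℕ) : β :=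
  Finset.inf {v ∈ insert ⊥ (Finset.univ.image s) | k ≤ #{m | s m ≤ v}} id

theorem lt_kthSmallest_iff {s : κ → β} {k : ℕ} {v : β} :
    v < kthSmallest s k ↔ v < ⊤ ∧ #{m | s m ≤ v} < k := by
  refine ⟨fun hv => ⟨hv.trans_le le_top, ?_⟩, fun ⟨hv, hcard⟩ => ?_⟩
  · by_contra! hk
    obtain ⟨w, hw, hmax⟩ := ({w ∈ insert ⊥ (Finset.univ.image s) | w ≤ v}).exists_max_image id
      ⟨⊥, by simp⟩
    simp only [Finset.mem_filter, id_eq] at hw hmax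
    have hcard : #{m | s m ≤ v} ≤ #{m | s m ≤ w} :=
      Finset.card_le_card fun m hm => by
        simp only [Finset.mem_filter, Finset.mem_univ, true_and] at hm ⊢
        exact hmax _ ⟨by simp, hm⟩
    have hle : kthSmallest s k ≤ w :=
      Finset.inf_le (f := id) (Finset.mem_filter.mpr ⟨hw.1, hk.trans hcard⟩)
    exact (hv.trans_le (hle.trans hw.2)).false
  · refine (Finset.lt_inf_iff hv).mpr fun w hw => ?_
    by_contra! hwv
    exact hcard.not_ge ((Finset.mem_filter.mp hw).2.trans (monotone_card_filter_le s hwv))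

theorem kthSmallest_succ_le_of_kthSmallest_lt {s : κ → β} {k : ℕ} {m : κ}
    (hm : kthSmallest s k < s m) : kthSmallest s (k + 1) ≤ s m := by
  by_contra! hlt
  obtain ⟨htop, hcard⟩ := lt_kthSmallest_iff.mp hlt
  have hless : #{i | s i ≤ kthSmallest s k} < #{i | s i ≤ s m} :=
    Finset.card_lt_card <| Finset.ssubset_iff_of_subset
      (Finset.monotone_filter_right _ fun _ _ hi => hi.trans hm.le) |>.mpr ⟨m, by simpa⟩
  exact lt_irrefl (kthSmallest s k) (lt_kthSmallest_iff.mpr ⟨hm.trans htop, by omega⟩)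

section Removal

variable [DecidableEq κ] (s : κ → β) (T : Finset κ)

theorem kthSmallest_le_kthSmallest_compl (k : ℕ) :
    kthSmallest s k ≤ kthSmallest (fun i : {i // i ∉ T} => s i) k := by
  refine le_of_forall_lt fun v hv => ?_
  rw [lt_kthSmallest_iff] at hv ⊢
  have := card_filter_le_eq_add s T v
  exact ⟨hv.1, by omega⟩

theorem kthSmallest_compl_le_kthSmallest_add_card (k : ℕ) :
    kthSmallest (fun i : {i // i ∉ T} => s i) k ≤ kthSmallest s (k + #T) := by
  refine le_of_forall_lt fun v hv => ?_
  rw [lt_kthSmallest_iff] at hv ⊢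
  have := card_filter_le_eq_add s T v
  have := T.card_filter_le (s · ≤ v)
  exact ⟨hv.1, by omega⟩

variable {s T}

theorem kthSmallest_compl_eq_of_forall_lt {k : ℕ} (hT : ∀ m ∈ T, kthSmallest s k < s m) :
    kthSmallest (fun i : {i // i ∉ T} => s i) k = kthSmallest s k := by
  refine (kthSmallest_le_kthSmallest_compl s T k).antisymm' <| not_lt.mp fun hlt => ?_
  obtain ⟨htop, hcard⟩ := lt_kthSmallest_iff.mp hlt
  have hzero : #{m ∈ T | s m ≤ kthSmallest s k} = 0 := by
    simpa [Finset.filter_eq_empty_iff] using hT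
  have := card_filter_le_eq_add s T (kthSmallest s k)
  exact lt_irrefl _ (lt_kthSmallest_iff.mpr ⟨htop, by omega⟩)

theorem kthSmallest_compl_eq_of_forall_lt_add_card {k : ℕ}
    (hT : ∀ m ∈ T, s m < kthSmallest s (k + #T)) :
    kthSmallest (fun i : {i // i ∉ T} => s i) k = kthSmallest s (k + #T) := by
  refine (kthSmallest_compl_le_kthSmallest_add_card s T k).antisymm <| not_lt.mp fun hlt => ?_
  have hv : kthSmallest (fun i : {i // i ∉ T} => s i) k ⊔ T.sup s < kthSmallest s (k + #T) :=
    sup_lt_iff.mpr ⟨hlt, (Finset.sup_lt_iff (bot_le.trans_lt hlt)).mpr hT⟩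
  obtain ⟨htop, hcard⟩ := lt_kthSmallest_iff.mp hv
  have hall : #{m ∈ T | s m ≤ kthSmallest (fun i : {i // i ∉ T} => s i) k ⊔ T.sup s} = #T := by
    rw [Finset.filter_true_of_mem fun m hm => (Finset.le_sup hm).trans le_sup_right]
  rw [card_filter_le_eq_add s T, hall] at hcard
  exact (lt_kthSmallest_iff.mpr ⟨htop, by omega⟩ : _ < kthSmallest _ k).not_ge le_sup_left

end Removal

/-- The indices whose value lies strictly between the order statistics of ranks `l` and `u`. -/
def binInterior (s : κ → β) (l u : ℕ) : Finset κ :=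
  {m | kthSmallest s l < s m ∧ s m < kthSmallest s u}

theorem mem_binInterior {s : κ → β} {l u : ℕ} {m : κ} :
    m ∈ binInterior s l u ↔ kthSmallest s l < s m ∧ s m < kthSmallest s u := by
  simp [binInterior]

section Removal

variable [DecidableEq κ] {s : κ → β} {l u : ℕ} {T : Finset κ}

theorem kthSmallest_compl_eq_of_binInterior_eq (hu : u = l + 1 + #T)
    (hT : binInterior s l u = T) :
    kthSmallest (fun i : {i // i ∉ T} => s i) l = kthSmallest s l ∧
      kthSmallest (fun i : {i // i ∉ T} => s i) (l + 1) = kthSmallest s u := by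
  have hmem (m) (hm : m ∈ T) := mem_binInterior.mp (hT ▸ hm)
  subst hu
  exact ⟨kthSmallest_compl_eq_of_forall_lt fun m hm => (hmem m hm).1,
    kthSmallest_compl_eq_of_forall_lt_add_card fun m hm => (hmem m hm).2⟩

theorem binInterior_eq_iff (hu : u = l + 1 + #T) :
    binInterior s l u = T ↔ ∀ m ∈ T,
      s m ∈ Set.Ioo (kthSmallest (fun i : {i // i ∉ T} => s i) l)
        (kthSmallest (fun i : {i // i ∉ T} => s i) (l + 1)) := by
  refine ⟨fun hT m hm => ?_, fun h => ?_⟩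
  · obtain ⟨hl, hu⟩ := kthSmallest_compl_eq_of_binInterior_eq hu hT
    rw [hl, hu]
    exact mem_binInterior.mp (hT ▸ hm)
  · subst hu
    have hl := kthSmallest_compl_eq_of_forall_lt fun m hm =>
      (kthSmallest_le_kthSmallest_compl s T l).trans_lt (h m hm).1
    have hu := kthSmallest_compl_eq_of_forall_lt_add_card fun m hm =>
      (h m hm).2.trans_le (kthSmallest_compl_le_kthSmallest_add_card s T (l + 1))
    ext m
    rw [mem_binInterior, ← hl, ← hu]
    refine ⟨fun ⟨hlm, hmu⟩ => ?_, h m⟩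
    by_contra hm
    exact hmu.not_ge
      (kthSmallest_succ_le_of_kthSmallest_lt (s := fun i : {i // i ∉ T} => s i) (m := ⟨m, hm⟩) hlm)

end Removal

variable [TopologicalSpace β] [OrderTopology β] [SecondCountableTopology β] [MeasurableSpace β]
  [BorelSpace β]

theorem measurable_kthSmallest (k : ℕ) :
    Measurable fun s : κ → β => kthSmallest s k := by
  refine measurable_of_Ioi fun v => ?_
  have hcount : Measurable fun s : κ → β => #{m | s m ≤ v} := by
    simp only [Finset.card_filter]
    exact Finset.measurable_fun_sum _ fun m _ =>
      Measurable.ite (measurable_pi_apply m measurableSet_Iic) measurable_const measurable_const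
  simp only [Set.preimage, Set.mem_Ioi, lt_kthSmallest_iff]
  exact (MeasurableSet.const _).inter (hcount measurableSet_Iio)

theorem measurableSet_binInterior_eq (l u : ℕ) (T : Finset κ) :
    MeasurableSet {s : κ → β | binInterior s l u = T} := by
  have hk := measurable_kthSmallest (κ := κ) (β := β)
  have hmem (m : κ) : MeasurableSet {s : κ → β | m ∈ binInterior s l u} := by
    simp only [mem_binInterior]
    exact (measurableSet_lt (hk l) (measurable_pi_apply m)).inter
      (measurableSet_lt (measurable_pi_apply m) (hk u))
  simp only [Finset.ext_iff, Set.ofPred_forall]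
  exact .iInter fun m => (hmem m).iff (.const _)

end KthSmallest

section SortedScores

variable {n : ℕ} {s : Fin n → unitInterval}

theorem orderStat_zero (s : Fin n → unitInterval) : orderStat s 0 = 0 := if_pos rfl

theorem orderStat_add_one_self (s : Fin n → unitInterval) : orderStat s (n + 1) = 1 := by
  simp [orderStat]

theorem orderStat_eq_kthSmallest (s : Fin n → unitInterval) (k : ℕ) :
    orderStat s k = kthSmallest s k := by
  refine eq_of_forall_lt_iff fun v => ?_
  rw [lt_kthSmallest_iff, orderStat]
  split_ifs with hk hkn
  · simp [hk]
  · have hiff := Tuple.lt_card_le_iff_apply_le_of_monotone (j := ⟨k - 1, hkn⟩)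
      (f := s ∘ Tuple.sort s) (a := v) (Tuple.monotone_sort s)
    have hcard : #{i | s (Tuple.sort s i) ≤ v} = #{i | s i ≤ v} := by
      simpa only [Finset.card_filter] using
        Equiv.sum_comp (Tuple.sort s) fun i => if s i ≤ v then 1 else 0
    simp only [Function.comp_apply, hcard] at hiff
    have hlt : v < s (Tuple.sort s ⟨k - 1, hkn⟩) ↔ #{i | s i ≤ v} < k := by
      rw [← not_le, ← hiff]
      omega
    rw [hlt]
    exact (and_iff_right_of_imp fun h => (hlt.mpr h).trans_le le_top).symm
  · have := Finset.card_le_univ ({m | s m ≤ v} : Finset (Fin n))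
    rw [Fintype.card_fin] at this
    exact (and_iff_left (by omega)).symm

/-- The rank of the score with index `m`, in `{1, …, n}`. -/
noncomputable def position (s : Fin n → unitInterval) (m : Fin n) : ℕ := (Tuple.sort s).symm m + 1

theorem position_injective (s : Fin n → unitInterval) : Function.Injective (position s) :=
  fun _ _ h => (Tuple.sort s).symm.injective (Fin.ext (Nat.succ_injective h))

theorem orderStat_position (s : Fin n → unitInterval) (m : Fin n) :
    orderStat s (position s m) = s m := by
  simp [orderStat, position]

theorem orderedLabel_position (s y : Fin n → unitInterval) (m : Fin n) :
    orderedLabel s y (position s m) = y m := by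
  simp [orderedLabel, position]

theorem exists_position_eq (s : Fin n → unitInterval) {k : ℕ} (hk : k ∈ Finset.Icc 1 n) :
    ∃ m, position s m = k := by
  rw [Finset.mem_Icc] at hk
  refine ⟨Tuple.sort s ⟨k - 1, by omega⟩, ?_⟩
  simp only [position, Equiv.symm_apply_apply]
  omega

theorem strictMonoOn_orderStat (hs : Function.Injective s) (hs01 : ∀ m, s m ∈ Set.Ioo 0 1) :
    StrictMonoOn (orderStat s) (Set.Iic (n + 1)) := by
  intro i _ j (hj : j ≤ n + 1) hij
  obtain rfl | hi := i.eq_zero_or_pos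
  · obtain rfl | hj := hj.eq_or_lt
    · rw [orderStat_add_one_self]
      exact zero_lt_one
    · obtain ⟨m, rfl⟩ := exists_position_eq s (Finset.mem_Icc.mpr ⟨hij, by omega⟩)
      rw [orderStat_position]
      exact (hs01 m).1
  · obtain ⟨m, rfl⟩ := exists_position_eq s (Finset.mem_Icc.mpr ⟨hi, by omega⟩)
    obtain rfl | hj := hj.eq_or_lt
    · rw [orderStat_add_one_self, orderStat_position]
      exact (hs01 m).2
    · obtain ⟨m', rfl⟩ := exists_position_eq s <|
        Finset.mem_Icc.mpr ⟨by omega, Nat.le_of_lt_succ hj⟩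
      refine (orderStat_mono s hij.le).lt_of_ne fun heq => hij.ne ?_
      rw [orderStat_position, orderStat_position] at heq
      rw [hs heq]

theorem image_position_binInterior (hs : Function.Injective s) (hs01 : ∀ m, s m ∈ Set.Ioo 0 1)
    {l u : ℕ} (hl : l ≤ n + 1) (hu : u ≤ n + 1) :
    (binInterior s l u).image (position s) = Finset.Ioo l u := by
  have hmono := strictMonoOn_orderStat hs hs01
  have hposition (m : Fin n) : position s m ≤ n + 1 := Nat.succ_le_succ (Fin.is_lt _).le
  have hmem (m : Fin n) : m ∈ binInterior s l u ↔ position s m ∈ Finset.Ioo l u := by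
    rw [mem_binInterior, Finset.mem_Ioo, ← orderStat_position s m, ← orderStat_eq_kthSmallest,
      ← orderStat_eq_kthSmallest, hmono.lt_iff_lt hl (hposition m),
      hmono.lt_iff_lt (hposition m) hu]
  ext k
  simp only [Finset.mem_image, hmem]
  refine ⟨fun ⟨_, hm, hmk⟩ => hmk ▸ hm, fun hk => ?_⟩
  have hk' : k ∈ Finset.Icc 1 n := by
    rw [Finset.mem_Ioo] at hk
    rw [Finset.mem_Icc]
    omega
  obtain ⟨m, rfl⟩ := exists_position_eq s hk'
  exact ⟨m, hk, rfl⟩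

theorem card_binInterior (hs : Function.Injective s) (hs01 : ∀ m, s m ∈ Set.Ioo 0 1)
    {l u : ℕ} (hl : l ≤ n + 1) (hu : u ≤ n + 1) : #(binInterior s l u) = u - l - 1 := by
  rw [← Nat.card_Ioo, ← image_position_binInterior hs hs01 hl hu,
    Finset.card_image_of_injective _ (position_injective s)]

theorem sum_orderedLabel_Ioo (hs : Function.Injective s) (hs01 : ∀ m, s m ∈ Set.Ioo 0 1)
    {l u : ℕ} (hl : l ≤ n + 1) (hu : u ≤ n + 1) (y : Fin n → unitInterval) :
    ∑ k ∈ Finset.Ioo l u, (orderedLabel s y k : ℝ) = ∑ m ∈ binInterior s l u, (y m : ℝ) := by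
  rw [← image_position_binInterior hs hs01 hl hu,
    Finset.sum_image (position_injective s).injOn]
  simp only [orderedLabel_position]

end SortedScores

section Concentration

variable {Z : Type*} [MeasurableSpace Z] {P : Measure Z} [IsProbabilityMeasure P]

theorem measureReal_pi_sum_ge_le_of_hasSubgaussianMGF {ι : Type*} [Fintype ι] {φ : Z → ℝ}
    (hφm : Measurable φ) {c : NNReal} (hφ : HasSubgaussianMGF φ c P) {r : ℝ} (hr : 0 ≤ r) :
    (Measure.pi fun _ : ι => P).real {x | r ≤ ∑ m, φ (x m)} ≤
      Real.exp (-r ^ 2 / (2 * (Fintype.card ι * c))) := by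
  have hcoord (m : ι) : HasSubgaussianMGF (fun x : ι → Z => φ (x m)) c (Measure.pi fun _ => P) :=
    .of_map (mΩ := inferInstance) (Y := fun x : ι → Z => x m) (X := φ)
      (measurable_pi_apply m).aemeasurable
      ((measurePreserving_eval (fun _ : ι => P) m).map_eq.symm ▸ hφ)
  simpa using HasSubgaussianMGF.measure_sum_ge_le_of_iIndepFun
    (iIndepFun_pi (μ := fun _ : ι => P) (X := fun _ => φ) fun _ => hφm.aemeasurable)
    (s := Finset.univ) (fun m _ => hcoord m) hr

variable {f : Z → ℝ} (hf : Measurable f) (hf01 : ∀ z, f z ∈ Set.Icc (0 : ℝ) 1) {t : ℝ} (ht : 0 ≤ t)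

include hf hf01 ht

theorem hoeffding_mean {ι : Type*} [Fintype ι] [Nonempty ι] :
    Measure.pi (fun _ : ι => P) {x | t < |(∑ m, f (x m)) / Fintype.card ι - ∫ z, f z ∂P|} ≤
      ENNReal.ofReal (2 * Real.exp (-2 * Fintype.card ι * t ^ 2)) := by
  set k : ℝ := (Fintype.card ι : ℝ) with hk
  have hkpos : 0 < k := Nat.cast_pos.mpr Fintype.card_pos
  have hsub : HasSubgaussianMGF (fun z => f z - ∫ z, f z ∂P) ((‖(1 : ℝ) - 0‖₊ / 2) ^ 2) P :=
    hasSubgaussianMGF_of_mem_Icc hf.aemeasurable (.of_forall hf01)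
  have htail {φ : Z → ℝ} (hφm : Measurable φ)
      (hφ : HasSubgaussianMGF φ ((‖(1 : ℝ) - 0‖₊ / 2) ^ 2) P) :
      (Measure.pi fun _ : ι => P).real {x | k * t ≤ ∑ m, φ (x m)} ≤
        Real.exp (-2 * k * t ^ 2) := by
    refine (measureReal_pi_sum_ge_le_of_hasSubgaussianMGF hφm hφ (by positivity)).trans_eq ?_
    congr 1
    simp only [sub_zero, nnnorm_one, NNReal.coe_pow, NNReal.coe_div, NNReal.coe_one,
      NNReal.coe_ofNat, ← hk]
    field_simp
  have hsum (x : ι → Z) :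
      ∑ m, (f (x m) - ∫ z, f z ∂P) = k * ((∑ m, f (x m)) / k - ∫ z, f z ∂P) := by
    rw [Finset.sum_sub_distrib, Finset.sum_const, Finset.card_univ, nsmul_eq_mul, ← hk]
    field_simp
  have hsubset : {x : ι → Z | t < |(∑ m, f (x m)) / k - ∫ z, f z ∂P|} ⊆
      {x | k * t ≤ ∑ m, (f (x m) - ∫ z, f z ∂P)} ∪
        {x | k * t ≤ ∑ m, -(f (x m) - ∫ z, f z ∂P)} := fun x hx => by
    simp only [Set.mem_union, Set.mem_ofPred_eq, Finset.sum_neg_distrib, hsum, ← mul_neg,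
      mul_le_mul_iff_right₀ hkpos]
    exact (lt_abs.mp hx).imp le_of_lt le_of_lt
  rw [← ofReal_measureReal]
  refine ENNReal.ofReal_le_ofReal ?_
  calc _ ≤ _ := measureReal_mono hsubset
    _ ≤ _ := measureReal_union_le _ _
    _ ≤ Real.exp (-2 * k * t ^ 2) + Real.exp (-2 * k * t ^ 2) :=
      add_le_add (htail (hf.sub_const _) hsub) (htail (hf.sub_const _).neg hsub.neg)
    _ = _ := (two_mul _).symm

end Concentration

section Cond

variable {Z : Type*} [MeasurableSpace Z]

theorem restrict_eq_smul_cond (P : Measure Z) [IsFiniteMeasure P] (I : Set Z) :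
    P.restrict I = P I • P[|I] := by
  by_cases h0 : P I = 0
  · rw [h0, zero_smul, Measure.restrict_eq_zero.mpr h0]
  · rw [ProbabilityTheory.cond, smul_smul, ENNReal.mul_inv_cancel h0 (measure_ne_top _ _), one_smul]

theorem pi_restrict_eq_smul_pi_cond {ι : Type*} [Fintype ι] (P : Measure Z)
    [IsFiniteMeasure P] (I : Set Z) :
    (Measure.pi fun _ : ι => P).restrict (Set.univ.pi fun _ => I) =
      Measure.pi (fun _ : ι => P) (Set.univ.pi fun _ => I) •
        Measure.pi (fun _ : ι => P[|I]) := by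
  rw [Measure.restrict_pi_pi, restrict_eq_smul_cond]
  have : IsFiniteMeasure (P I • P[|I]) := Measure.smul_finite _ (measure_ne_top _ _)
  refine Measure.pi_eq fun s _ => ?_
  simp [Measure.pi_pi, Finset.prod_mul_distrib]

theorem integral_cond_eq_setIntegral_div (P : Measure Z) (f : Z → ℝ) (I : Set Z) :
    ∫ z, f z ∂P[|I] = (∫ z in I, f z ∂P) / P.real I := by
  rw [ProbabilityTheory.cond, integral_smul_measure, ENNReal.toReal_inv, smul_eq_mul,
    div_eq_inv_mul, Measure.real]

theorem integral_cond_congr_set {P : Measure Z} {I J : Set Z} (hIJ : I =ᵐ[P] J) (f : Z → ℝ) :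
    ∫ z, f z ∂P[|I] = ∫ z, f z ∂P[|J] := by
  rw [integral_cond_eq_setIntegral_div, integral_cond_eq_setIntegral_div,
    setIntegral_congr_set hIJ, measureReal_congr hIJ]

theorem measurable_integral_cond {W : Type*} [MeasurableSpace W] (P : Measure Z) [SFinite P]
    {f : Z → ℝ} (hf : Measurable f) {J : W → Set Z} (hJ : MeasurableSet {p : W × Z | p.2 ∈ J p.1}) :
    Measurable fun w => ∫ z, f z ∂P[|J w] := by
  have hslice (w : W) : MeasurableSet (J w) := measurable_prodMk_left hJ
  simp only [integral_cond_eq_setIntegral_div, ← integral_indicator (hslice _)]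
  refine Measurable.div ?_ (measurable_measure_prodMk_left hJ).ennreal_toReal
  exact (StronglyMeasurable.integral_prod_right' (ν := P) (f := Set.indicator _ fun p => f p.2)
    ((hf.comp measurable_snd).indicator hJ).stronglyMeasurable).measurable

theorem measurableSet_lt_abs_mean_sub_integral_cond {P : Measure Z} [SFinite P] {f : Z → ℝ}
    (hf : Measurable f) {t : ℝ} {ι W : Type*} [Fintype ι] [MeasurableSpace W] {J : W → Set Z}
    (hJ : MeasurableSet {p : W × Z | p.2 ∈ J p.1}) :
    MeasurableSet {p : (ι → Z) × W |
      t < |(∑ m, f (p.1 m)) / Fintype.card ι - ∫ z, f z ∂P[|J p.2]|} := by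
  have hmean : Measurable fun p : (ι → Z) × W => ∫ z, f z ∂P[|J p.2] :=
    (measurable_integral_cond P hf hJ).comp measurable_snd
  exact measurableSet_lt measurable_const (by fun_prop)

theorem prod_le_mul_prod_of_forall_section_le {W : Type*} [MeasurableSpace W] {μ : Measure Z}
    {ν : Measure W} [SFinite μ] [SFinite ν] {E F : Set (Z × W)} (hE : MeasurableSet E)
    (hF : MeasurableSet F) {c : ENNReal}
    (h : ∀ w, μ {z | (z, w) ∈ F} ≤ c * μ {z | (z, w) ∈ E}) :
    μ.prod ν F ≤ c * μ.prod ν E := by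
  rw [Measure.prod_apply_symm hE, Measure.prod_apply_symm hF,
    ← lintegral_const_mul _ (measurable_measure_prodMk_right hE)]
  exact lintegral_mono h

variable {P : Measure Z} [IsProbabilityMeasure P] {f : Z → ℝ} (hf : Measurable f)
  (hf01 : ∀ z, f z ∈ Set.Icc (0 : ℝ) 1) {t : ℝ} (ht : 0 ≤ t)

include hf hf01 ht

theorem hoeffding_mean_cond {ι : Type*} [Fintype ι] [Nonempty ι] (I : Set Z) :
    Measure.pi (fun _ : ι => P) {x | (∀ m, x m ∈ I) ∧
        t < |(∑ m, f (x m)) / Fintype.card ι - ∫ z, f z ∂P[|I]|} ≤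
      ENNReal.ofReal (2 * Real.exp (-2 * Fintype.card ι * t ^ 2)) *
        Measure.pi (fun _ : ι => P) {x | ∀ m, x m ∈ I} := by
  have hbox : {x : ι → Z | ∀ m, x m ∈ I} = Set.univ.pi fun _ => I := by
    ext x
    simp
  have hmeas : MeasurableSet {x : ι → Z |
      t < |(∑ m, f (x m)) / Fintype.card ι - ∫ z, f z ∂P[|I]|} :=
    measurableSet_lt measurable_const (by fun_prop)
  rw [Set.ofPred_and, Set.inter_comm, ← Measure.restrict_apply hmeas, hbox,
    pi_restrict_eq_smul_pi_cond, Measure.smul_apply, smul_eq_mul, mul_comm]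
  by_cases h0 : P I = 0
  · simp [Measure.pi_pi, h0]
  · have := cond_isProbabilityMeasure h0
    gcongr
    exact hoeffding_mean hf hf01 ht

theorem hoeffding_mean_cond_prod {ι W : Type*} [Fintype ι] [Nonempty ι] [MeasurableSpace W]
    (ν : Measure W) [SFinite ν] {J : W → Set Z} (hJ : MeasurableSet {p : W × Z | p.2 ∈ J p.1}) :
    (Measure.pi fun _ : ι => P).prod ν {p | (∀ m, p.1 m ∈ J p.2) ∧
        t < |(∑ m, f (p.1 m)) / Fintype.card ι - ∫ z, f z ∂P[|J p.2]|} ≤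
      ENNReal.ofReal (2 * Real.exp (-2 * Fintype.card ι * t ^ 2)) *
        (Measure.pi fun _ : ι => P).prod ν {p | ∀ m, p.1 m ∈ J p.2} := by
  have hbox : MeasurableSet {p : (ι → Z) × W | ∀ m, p.1 m ∈ J p.2} := by
    have hcoord (m : ι) : Measurable fun p : (ι → Z) × W => (p.2, p.1 m) := by fun_prop
    rw [Set.ofPred_forall]
    exact .iInter fun m => hcoord m hJ
  exact prod_le_mul_prod_of_forall_section_le hbox
    (hbox.inter (measurableSet_lt_abs_mean_sub_integral_cond hf hJ))
    fun w => hoeffding_mean_cond hf hf01 ht (J w)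

-- Conditionally on the points outside `T`, the points in `T` are i.i.d. on a fixed cell.
theorem hoeffding_mean_randomCell {κ : Type*} [Fintype κ] {T : Finset κ}
    (hT : T.Nonempty) {J : ({i // i ∉ T} → Z) → Set Z}
    (hJ : MeasurableSet {p : ({i // i ∉ T} → Z) × Z | p.2 ∈ J p.1}) :
    Measure.pi (fun _ : κ => P) {x | (∀ m ∈ T, x m ∈ J fun i => x i) ∧
        t < |(∑ m ∈ T, f (x m)) / #T - ∫ z, f z ∂P[|J fun i => x i]|} ≤
      ENNReal.ofReal (2 * Real.exp (-2 * #T * t ^ 2)) *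
        Measure.pi (fun _ : κ => P) {x | ∀ m ∈ T, x m ∈ J fun i => x i} := by
  classical
  have : Nonempty {i // i ∈ T} := hT.to_subtype
  have hsplit : MeasurePreserving (MeasurableEquiv.piEquivPiSubtypeProd (fun _ => Z) (· ∈ T))
      (Measure.pi fun _ => P)
      ((Measure.pi fun _ : {i // i ∈ T} => P).prod (Measure.pi fun _ : {i // i ∉ T} => P)) := by
    convert measurePreserving_piEquivPiSubtypeProd (fun _ : κ => P) (· ∈ T)
  have hprod := hoeffding_mean_cond_prod (P := P) (ι := {i // i ∈ T}) hf hf01 ht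
    (Measure.pi fun _ : {i // i ∉ T} => P) hJ
  rw [← hsplit.measure_preimage_equiv, ← hsplit.measure_preimage_equiv, Fintype.card_coe] at hprod
  have hcoe (x : κ → Z) : (∀ m ∈ T, x m ∈ J fun i => x i) ↔
      ∀ m : {i // i ∈ T}, x m ∈ J fun i => x i := by simp only [Subtype.forall]
  simp only [hcoe, ← Finset.sum_coe_sort T]
  exact hprod

end Cond

section Generic

variable {κ β : Type*} [Fintype κ] [MeasurableSpace β] (μ : Measure β) [IsProbabilityMeasure μ]
  [NullSingletonClass μ]

theorem ae_injective_pi [MeasurableEq β] :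
    ∀ᵐ s ∂Measure.pi fun _ : κ => μ, Function.Injective s := by
  have hpair (i j : κ) (hij : i ≠ j) : ∀ᵐ s ∂Measure.pi fun _ : κ => μ, s i ≠ s j := by
    have hindep : IndepFun (fun s : κ → β => s i) (fun s => s j) (Measure.pi fun _ => μ) :=
      (iIndepFun_pi (X := fun _ => id) fun _ => aemeasurable_id).indepFun hij
    rw [indepFun_iff_map_prod_eq_prod_map_map (measurable_pi_apply i).aemeasurable
      (measurable_pi_apply j).aemeasurable, (measurePreserving_eval (fun _ => μ) i).map_eq,
      (measurePreserving_eval (fun _ => μ) j).map_eq] at hindep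
    have hdiag : ∀ᵐ p ∂μ.prod μ, p.1 ≠ p.2 := by
      have hgraph : MeasurableSet {p : β × β | p.1 = p.2} :=
        measurableSet_eq_fun measurable_fst measurable_snd
      simp only [ae_iff, not_not]
      refine (Measure.measure_prod_null hgraph).mpr (.of_forall fun c => ?_)
      have hslice : Prod.mk c ⁻¹' {p : β × β | p.1 = p.2} = {c} := Set.ext fun _ => eq_comm
      exact (congrArg μ hslice).trans (measure_singleton c)
    rw [← hindep] at hdiag
    exact ae_of_ae_map (f := fun s : κ → β => (s i, s j)) (by fun_prop) hdiag
  have hall : ∀ᵐ s ∂Measure.pi fun _ : κ => μ, ∀ i j, i ≠ j → s i ≠ s j := by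
    simpa only [ae_all_iff] using hpair
  filter_upwards [hall] with s hs i j hij
  exact by_contra fun hne => hs i j hne hij

theorem ae_injective_and_mem_Ioo {Z : Type*} [MeasurableSpace Z] (P : Measure Z)
    [IsProbabilityMeasure P] {σ : Z → unitInterval} (hσ : Measurable σ)
    [NullSingletonClass (P.map σ)] :
    ∀ᵐ x ∂Measure.pi fun _ : κ => P, Function.Injective (fun m => σ (x m)) ∧
      ∀ m, σ (x m) ∈ Set.Ioo 0 1 := by
  have := Measure.isProbabilityMeasure_map (μ := P) hσ.aemeasurable
  have hlaw : (Measure.pi fun _ : κ => P).map (fun x m => σ (x m)) = Measure.pi fun _ => P.map σ :=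
    Measure.pi_map_pi fun _ => hσ.aemeasurable
  have hne (c : unitInterval) : ∀ᵐ s ∂Measure.pi fun _ : κ => P.map σ, ∀ m, s m ≠ c :=
    ae_all_iff.mpr fun m => Measure.ae_eval_ne (fun _ => P.map σ) m c
  have hgeneric : ∀ᵐ s ∂(Measure.pi fun _ : κ => P).map (fun x m => σ (x m)),
      Function.Injective s ∧ ∀ m, s m ∈ Set.Ioo 0 1 := by
    rw [hlaw]
    filter_upwards [ae_injective_pi (P.map σ), hne 0, hne 1] with s hs hs0 hs1
    exact ⟨hs, fun m => ⟨unitInterval.pos_iff_ne_zero.mpr (hs0 m),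
      unitInterval.lt_one_iff_ne_one.mpr (hs1 m)⟩⟩
  exact ae_of_ae_map (measurable_pi_lambda _ fun m => hσ.comp (measurable_pi_apply m)).aemeasurable
    hgeneric

end Generic

section BinDeviation

variable {Z β κ : Type*} [MeasurableSpace Z] [LinearOrder β] [BoundedOrder β] [TopologicalSpace β]
  [OrderTopology β] [SecondCountableTopology β] [MeasurableSpace β] [BorelSpace β] [Fintype κ]

/-- The points whose score `σ` lies strictly between the scores of ranks `l` and `u` of the
sample `x`. -/
def openBin (σ : Z → β) (l u : ℕ) (x : κ → Z) : Set Z :=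
  σ ⁻¹' Set.Ioo (kthSmallest (fun m => σ (x m)) l) (kthSmallest (fun m => σ (x m)) u)

theorem measurableSet_openBin_graph {σ : Z → β} (hσ : Measurable σ) (l u : ℕ) :
    MeasurableSet {p : (κ → Z) × Z | p.2 ∈ openBin σ l u p.1} := by
  have hkth (k : ℕ) : Measurable fun p : (κ → Z) × Z => kthSmallest (fun m => σ (p.1 m)) k :=
    (measurable_kthSmallest k).comp (by fun_prop)
  exact (measurableSet_lt (hkth l) (by fun_prop)).inter (measurableSet_lt (by fun_prop) (hkth u))

variable {P : Measure Z} [IsProbabilityMeasure P] {σ : Z → β} {f : Z → ℝ} {t : ℝ} {l u : ℕ}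
  (hσ : Measurable σ) (hf : Measurable f) (hf01 : ∀ z, f z ∈ Set.Icc (0 : ℝ) 1) (ht : 0 ≤ t)

include hσ hf hf01 ht

theorem measure_binInterior_eq_and_lt_abs_le {T : Finset κ} (hT : T.Nonempty)
    (hu : u = l + 1 + #T) :
    Measure.pi (fun _ : κ => P) {x | binInterior (fun m => σ (x m)) l u = T ∧
        t < |(∑ m ∈ T, f (x m)) / #T - ∫ z, f z ∂P[|openBin σ l u x]|} ≤
      ENNReal.ofReal (2 * Real.exp (-2 * #T * t ^ 2)) *
        Measure.pi (fun _ : κ => P) {x | binInterior (fun m => σ (x m)) l u = T} := by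
  classical
  have hiff (x : κ → Z) : binInterior (fun m => σ (x m)) l u = T ↔
      ∀ m ∈ T, x m ∈ openBin σ l (l + 1) fun i : {i // i ∉ T} => x i := binInterior_eq_iff hu
  have hbin (x : κ → Z) (hx : binInterior (fun m => σ (x m)) l u = T) :
      openBin σ l u x = openBin σ l (l + 1) fun i : {i // i ∉ T} => x i := by
    obtain ⟨hl, hu⟩ := kthSmallest_compl_eq_of_binInterior_eq hu hx
    rw [openBin, openBin, hl, hu]
  refine le_of_eq_of_le (congrArg _ <| Set.ext fun x => ?_) <|
    (hoeffding_mean_randomCell hf hf01 ht hT (measurableSet_openBin_graph hσ l (l + 1))).trans_eq ?_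
  · simp only [Set.mem_ofPred_eq, ← hiff]
    exact and_congr_right fun hx => by rw [hbin x hx]
  · simp only [hiff]

theorem measure_lt_abs_binInterior_mean_sub_le (hlu : l + 1 < u)
    (hcard : ∀ᵐ x ∂Measure.pi fun _ : κ => P, #(binInterior (fun m => σ (x m)) l u) = u - l - 1) :
    Measure.pi (fun _ : κ => P) {x |
        t < |(∑ m ∈ binInterior (fun m => σ (x m)) l u, f (x m)) / (u - l - 1 : ℕ) -
          ∫ z, f z ∂P[|openBin σ l u x]|} ≤
      ENNReal.ofReal (2 * Real.exp (-2 * (u - l - 1 : ℕ) * t ^ 2)) := by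
  set c := ENNReal.ofReal (2 * Real.exp (-2 * (u - l - 1 : ℕ) * t ^ 2))
  let interiorEq (T : Finset κ) : Set (κ → Z) := {x | binInterior (fun m => σ (x m)) l u = T}
  let deviation (T : Finset κ) : Set (κ → Z) := {x | binInterior (fun m => σ (x m)) l u = T ∧
    t < |(∑ m ∈ T, f (x m)) / #T - ∫ z, f z ∂P[|openBin σ l u x]|}
  let cells : Finset (Finset κ) := Finset.powersetCard (u - l - 1) Finset.univ
  have hdisj : (cells : Set (Finset κ)).PairwiseDisjoint interiorEq := fun T _ T' _ hne =>
    Set.disjoint_left.mpr fun x hx hx' => hne (hx.symm.trans hx')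
  have hmeas (T : Finset κ) : MeasurableSet (interiorEq T) :=
    (measurable_pi_lambda _ fun m => hσ.comp (measurable_pi_apply m))
      (measurableSet_binInterior_eq l u T)
  calc _ ≤ Measure.pi (fun _ : κ => P) (⋃ T ∈ cells, deviation T) := by
        refine measure_mono_ae ?_
        filter_upwards [hcard] with x hx hdev
        refine Set.mem_iUnion₂.mpr ⟨_, Finset.mem_powersetCard_univ.mpr hx, rfl, ?_⟩
        rwa [hx]
    _ ≤ ∑ T ∈ cells, Measure.pi (fun _ : κ => P) (deviation T) := measure_biUnion_finset_le _ _
    _ ≤ ∑ T ∈ cells, c * Measure.pi (fun _ : κ => P) (interiorEq T) := by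
        refine Finset.sum_le_sum fun T hT => ?_
        rw [Finset.mem_powersetCard_univ] at hT
        refine (measure_binInterior_eq_and_lt_abs_le hσ hf hf01 ht
          (Finset.card_pos.mp (by omega)) (by omega)).trans_eq ?_
        rw [hT]
    _ = c * Measure.pi (fun _ : κ => P) (⋃ T ∈ cells, interiorEq T) := by
        rw [← Finset.mul_sum, measure_biUnion_finset hdisj fun T _ => hmeas T]
    _ ≤ c := mul_le_of_le_one_right' prob_le_one

end BinDeviation

section CondExp

variable {Z : Type*} {m₀ : MeasurableSpace Z} {P : Measure Z} [IsFiniteMeasure P]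

theorem ae_measure_preimage_singleton_ne_zero {ι : Type*} [Countable ι] (P : Measure Z)
    (κ : Z → ι) : ∀ᵐ z ∂P, P (κ ⁻¹' {κ z}) ≠ 0 := by
  have hnull (b : ι) : ∀ᵐ z ∂P, κ z = b → P (κ ⁻¹' {b}) ≠ 0 := by
    by_cases hb : P (κ ⁻¹' {b}) = 0
    · filter_upwards [measure_eq_zero_iff_ae_notMem.mp hb] with z hz hzb using absurd hzb hz
    · exact .of_forall fun _ _ => hb
  filter_upwards [ae_all_iff.mpr hnull] with z hz using hz _ rfl

theorem condExp_comap_ae_eq_integral_cond {ι : Type*} [Countable ι] [MeasurableSpace ι]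
    [MeasurableSingletonClass ι] {κ : Z → ι} (hκ : Measurable κ) {f : Z → ℝ}
    (hf : Integrable f P) :
    P[f | MeasurableSpace.comap κ inferInstance] =ᵐ[P] fun z => ∫ w, f w ∂P[|κ ⁻¹' {κ z}] := by
  obtain ⟨ψ, -, hψ⟩ := (stronglyMeasurable_condExp (μ := P) (f := f)
    (m := MeasurableSpace.comap κ inferInstance)).exists_eq_measurable_comp
  filter_upwards [ae_measure_preimage_singleton_ne_zero P κ] with z hz
  have hfiber : MeasurableSet (κ ⁻¹' {κ z}) := hκ (measurableSet_singleton _)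
  have hpos : P.real (κ ⁻¹' {κ z}) ≠ 0 := (ENNReal.toReal_pos hz (measure_ne_top _ _)).ne'
  have hconst : ∫ w in κ ⁻¹' {κ z}, f w ∂P = P.real (κ ⁻¹' {κ z}) * ψ (κ z) := by
    rw [← setIntegral_condExp hκ.comap_le hf ⟨_, measurableSet_singleton _, rfl⟩,
      setIntegral_congr_fun hfiber (g := fun _ => ψ (κ z)) fun w hw => ?_, setIntegral_const,
      smul_eq_mul]
    rw [hψ, Function.comp_apply, show κ w = κ z from hw]
  rw [integral_cond_eq_setIntegral_div, hconst, mul_div_cancel_left₀ _ hpos, hψ,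
    Function.comp_apply]

theorem ae_abs_condExp_sub_le_of_le {m₁ m₂ : MeasurableSpace Z} (hm₁₂ : m₁ ≤ m₂) (hm₂ : m₂ ≤ m₀)
    {f h : Z → ℝ} (hh : StronglyMeasurable[m₁] h) (hhi : Integrable h P) {ε : ℝ}
    (hb : ∀ᵐ z ∂P, |P[f | m₂] z - h z| ≤ ε) : ∀ᵐ z ∂P, |P[f | m₁] z - h z| ≤ ε := by
  have hproj : P[fun z => P[f | m₂] z - h z | m₁] =ᵐ[P] fun z => P[f | m₁] z - h z := by
    refine (condExp_sub integrable_condExp hhi m₁).trans ?_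
    rw [condExp_of_stronglyMeasurable (hm₁₂.trans hm₂) hh hhi]
    exact (condExp_condExp_of_le hm₁₂ hm₂).sub .rfl
  filter_upwards [hproj, ae_bdd_abs_condExp_of_ae_bdd_abs (m := m₁) hb] with z hz hbound
  rwa [hz] at hbound

end CondExp

section Calibration

variable {𝒳 : Type*} [MeasurableSpace 𝒳] {P : Measure (𝒳 × unitInterval)} {h : Predictor 𝒳} {ε : ℝ}

-- A version of `r ↦ E[Y | h(X) = r]` may be clamped to `[r - ε, r + ε]`: this only alters it on a
-- null set.
theorem approxCalibrated_of_ae (hε : 0 ≤ ε) (hb : ∀ᵐ z ∂P, |condMean P h z - h.1 z.1| ≤ ε) :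
    ApproxCalibrated P h ε := by
  obtain ⟨ψ, hψm, hψ⟩ := (stronglyMeasurable_condExp (μ := P)
    (f := fun z : 𝒳 × unitInterval => (z.2 : ℝ)) (m := MeasurableSpace.comap
      (fun z : 𝒳 × unitInterval => h.1 z.1) inferInstance)).exists_eq_measurable_comp
  have := hψm.measurable
  refine ⟨fun r => max (r - ε) (min (r + ε) (ψ r)), ⟨by fun_prop, ?_⟩, fun r _ => ?_⟩
  · filter_upwards [hb] with z hz
    have hcond : condMean P h z = ψ (h.1 z.1) := congrFun hψ z
    rw [hcond, abs_sub_le_iff] at hz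
    rw [hcond, min_eq_right (by linarith), max_eq_right (by linarith)]
  · rw [abs_sub_le_iff]
    constructor
    · linarith [max_le (a := (r : ℝ) - ε) (by linarith) (min_le_left ((r : ℝ) + ε) (ψ r))]
    · linarith [le_max_left ((r : ℝ) - ε) (min (r + ε) (ψ r))]

theorem measurable_score (g : Predictor 𝒳) : Measurable fun z : 𝒳 × unitInterval => g.1 z.1 :=
  g.2.comp measurable_fst

theorem ApproxCalibrated.ece_le [IsProbabilityMeasure P] (hh : ApproxCalibrated P h ε) (hε : 0 ≤ ε)
    {p : ℝ} (hp : 0 < p) : ece P h p ≤ ε := by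
  obtain ⟨φ, ⟨-, hφ⟩, hb⟩ := hh
  have hnn (z : 𝒳 × unitInterval) : 0 ≤ |condMean P h z - h.1 z.1| ^ p := by positivity
  rw [ece, one_div, Real.rpow_inv_le_iff_of_pos (integral_nonneg hnn) hε hp]
  have hbound : ∀ᵐ z ∂P, |condMean P h z - h.1 z.1| ^ p ≤ ε ^ p := by
    filter_upwards [hφ] with z hz
    rw [← hz]
    exact Real.rpow_le_rpow (abs_nonneg _) (hb _ ⟨z.1, rfl⟩) hp.le
  calc _ ≤ ∫ _, ε ^ p ∂P :=
        integral_mono_of_nonneg (.of_forall hnn) (integrable_const _) hbound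
    _ = ε ^ p := by simp

theorem approxCalibrated_of_comp [IsProbabilityMeasure P] {ι : Type*} [Countable ι]
    [MeasurableSpace ι] [MeasurableSingletonClass ι] {κ : 𝒳 × unitInterval → ι} (hκ : Measurable κ)
    {G : ι → unitInterval} (hG : ∀ z, h.1 z.1 = G (κ z)) (hε : 0 ≤ ε)
    (hb : ∀ᵐ z ∂P, |∫ w, (w.2 : ℝ) ∂P[|κ ⁻¹' {κ z}] - h.1 z.1| ≤ ε) :
    ApproxCalibrated P h ε := by
  have hlabel : Integrable (fun z : 𝒳 × unitInterval => (z.2 : ℝ)) P :=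
    .of_mem_Icc 0 1 (by fun_prop) (.of_forall fun z => z.2.2)
  have hhi : Integrable (fun z : 𝒳 × unitInterval => (h.1 z.1 : ℝ)) P :=
    .of_mem_Icc 0 1 (measurable_score h).subtype_val.aemeasurable (.of_forall fun z => (h.1 z.1).2)
  have hcomap : MeasurableSpace.comap (fun z : 𝒳 × unitInterval => h.1 z.1) inferInstance ≤
      MeasurableSpace.comap κ inferInstance := by
    rw [funext hG, ← Function.comp_def, ← MeasurableSpace.comap_comp]
    exact MeasurableSpace.comap_mono (measurable_of_countable G).comap_le
  refine approxCalibrated_of_ae hε (ae_abs_condExp_sub_le_of_le hcomap hκ.comap_le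
    (measurable_subtype_coe.comp (comap_measurable _)).stronglyMeasurable hhi ?_)
  filter_upwards [hb, condExp_comap_ae_eq_integral_cond hκ hlabel] with z hz hcond
  rwa [hcond]

end Calibration

section Bins

theorem boundary_zero (n B : ℕ) : boundary n B 0 = 0 := by
  simp [boundary]

theorem boundary_self (n : ℕ) {B : ℕ} (hB : 1 ≤ B) : boundary n B B = n + 1 := by
  have : (B : ℚ) ≠ 0 := by positivity
  rw [boundary, mul_div_cancel₀ _ this]
  exact_mod_cast Nat.ceil_natCast (R := ℚ) (n + 1)

theorem boundary_add_div_le (n B b : ℕ) : boundary n B b + n / B ≤ boundary n B (b + 1) := by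
  rw [boundary, boundary, ← Nat.ceil_add_natCast (by positivity)]
  gcongr
  have : ((n / B : ℕ) : ℚ) ≤ ((n : ℚ) + 1) / B := Nat.cast_div_le.trans (by gcongr; linarith)
  push_cast
  linarith

variable {n B : ℕ} (s : Fin n → unitInterval)

/-- The number `b < B` of the bin `[S_(A_b), S_(A_{b+1}))` that contains the score `t`, counting
bins from zero; it is `B` for the score `1`, which lies in no bin. -/
noncomputable def binIndex (B : ℕ) (s : Fin n → unitInterval) (t : unitInterval) : ℕ :=
  Nat.findGreatest (fun b => orderStat s (boundary n B b) ≤ t) B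

theorem measurable_binIndex (B : ℕ) : Measurable (binIndex B s) :=
  measurable_findGreatest fun _ _ => measurableSet_Ici

theorem binIndex_eq_iff {b : ℕ} (hb : b < B) {t : unitInterval} :
    binIndex B s t = b ↔
      t ∈ Set.Ico (orderStat s (boundary n B b)) (orderStat s (boundary n B (b + 1))) := by
  have hmono := (orderStat_mono s).comp (boundary_mono n B)
  rw [binIndex, Nat.findGreatest_eq_iff, Set.mem_Ico, and_iff_right hb.le]
  refine and_congr ⟨fun h => ?_, fun h _ => h⟩
    ⟨fun h => not_le.mp (h b.lt_succ_self hb), fun h c hc _ => not_le.mpr (h.trans_le (hmono hc))⟩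
  rcases eq_or_ne b 0 with rfl | hb0
  · rw [boundary_zero, orderStat_zero]
    exact unitInterval.nonneg'
  · exact h hb0

theorem binIndex_lt (hB : 1 ≤ B) {t : unitInterval} (ht : t < 1) : binIndex B s t < B := by
  refine (Nat.findGreatest_le B).lt_of_ne fun h => ht.not_ge ?_
  have hlast := Nat.findGreatest_of_ne_zero h (by omega)
  rwa [boundary_self n hB, orderStat_add_one_self] at hlast

theorem binnedScore_eq (y : Fin n → unitInterval) (t : unitInterval) :
    binnedScore B s y t =
      if binIndex B s t < B then biasEstimate B s y (binIndex B s t + 1) else 0 := by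
  have hterm (b : ℕ) (hb : b ∈ Finset.Icc 1 B) :
      (orderStat s (boundary n B (b - 1)) ≤ t ∧ t < orderStat s (boundary n B b)) ↔
        binIndex B s t + 1 = b := by
    obtain ⟨c, rfl⟩ := Nat.exists_eq_add_of_le' (Finset.mem_Icc.mp hb).1
    rw [Nat.add_right_cancel_iff, binIndex_eq_iff s (Finset.mem_Icc.mp hb).2, Set.mem_Ico,
      Nat.add_sub_cancel]
  rw [binnedScore, Finset.sum_congr rfl fun b hb => if_congr (hterm b hb) rfl rfl,
    Finset.sum_ite_eq]
  simp

theorem sum_coe_mem_Icc {ι : Type*} (F : Finset ι) (y : ι → unitInterval) :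
    ∑ i ∈ F, (y i : ℝ) ∈ Set.Icc (0 : ℝ) #F :=
  ⟨Finset.sum_nonneg fun i _ => (y i).2.1,
    (Finset.sum_le_card_nsmul F _ 1 fun i _ => (y i).2.2).trans_eq (by simp)⟩

theorem abs_mean_insert_sub_mean_le {k : ℕ} (hk : 1 ≤ k) {S y : ℝ} (hS : S ∈ Set.Icc (0 : ℝ) k)
    (hy : y ∈ Set.Icc (0 : ℝ) 1) : |(y + S) / (k + 1) - S / k| ≤ 1 / (k + 1) := by
  have hk' : (0 : ℝ) < k := by positivity
  have hsub : (y + S) / (k + 1) - S / k = (y - S / k) / (k + 1) := by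
    field_simp
    ring
  have hmean : S / k ∈ Set.Icc (0 : ℝ) 1 := ⟨div_nonneg hS.1 hk'.le, (div_le_one hk').mpr hS.2⟩
  rw [hsub, abs_div, abs_of_pos (by positivity : (0 : ℝ) < k + 1)]
  gcongr
  exact abs_sub_le_of_nonneg_of_le hy.1 hy.2 hmean.1 hmean.2

theorem abs_biasEstimate_sub_le {b : ℕ} (hb : b < B) (hn : 2 * B ≤ n)
    (y : Fin n → unitInterval) :
    |biasEstimate B s y (b + 1) -
        (∑ k ∈ Finset.Ioo (boundary n B b) (boundary n B (b + 1)), (orderedLabel s y k : ℝ)) /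
          (boundary n B (b + 1) - boundary n B b - 1 : ℕ)| ≤ 1 / (n / B : ℕ) := by
  have hstep := boundary_add_div_le n B b
  have hdiv : 2 ≤ n / B := (Nat.le_div_iff_mul_le (by omega)).mpr hn
  rw [biasEstimate, binRanks, Nat.add_sub_cancel]
  set l := boundary n B b
  set u := boundary n B (b + 1)
  split_ifs with hlast
  · have hcard : (#(Finset.Ioc l u) : ℝ) = (u - l - 1 : ℕ) + 1 := by
      rw [Nat.card_Ioc]
      exact_mod_cast (by omega : u - l = (u - l - 1) + 1)
    rw [hcard, ← Finset.Ioo_insert_right (by omega : l < u), Finset.sum_insert (by simp)]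
    refine (abs_mean_insert_sub_mean_le (by omega) ?_ (orderedLabel s y u).2).trans ?_
    · rw [← Nat.card_Ioo]
      exact sum_coe_mem_Icc _ _
    · gcongr
      exact_mod_cast (by omega : n / B ≤ (u - l - 1) + 1)
  · have hIoo : Finset.Ioc l (u - 1) = Finset.Ioo l u := by
      ext k
      simp only [Finset.mem_Ioc, Finset.mem_Ioo]
      omega
    rw [hIoo, Nat.card_Ioo, sub_self, abs_zero]
    positivity

theorem two_mul_exp_neg_mul_sq_sqrt_le {K δ : ℝ} (hK : 0 < K) (hδ : 0 < δ) :
    2 * Real.exp (-2 * K * √(Real.log (2 / δ) / (2 * K)) ^ 2) ≤ δ := by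
  have hsq : Real.log (2 / δ) / (2 * K) ≤ √(Real.log (2 / δ) / (2 * K)) ^ 2 :=
    Real.sq_sqrt' ▸ le_max_left _ _
  rw [div_le_iff₀ (by positivity)] at hsq
  calc _ ≤ 2 * Real.exp (-Real.log (2 / δ)) := by
        gcongr
        linarith
    _ = δ := by
        rw [Real.exp_neg, Real.exp_log (by positivity)]
        field_simp

end Bins

section Histogram

variable {𝒳 : Type*} [MeasurableSpace 𝒳] {P : Measure (𝒳 × unitInterval)} {n : ℕ}

theorem HoldsWithProb.mono {α α' : ℝ} {A A' : Dataset 𝒳 n → Prop} (h : HoldsWithProb P n α A)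
    (hα : α ≤ α') (hA : ∀ D, A D → A' D) : HoldsWithProb P n α' A' :=
  (measure_mono fun D => mt (hA D)).trans (h.trans (ENNReal.ofReal_le_ofReal hα))

theorem holdsWithProb_forall_of_forall {ι : Type*} {F : Finset ι} {α : ι → ℝ}
    {A : ι → Dataset 𝒳 n → Prop} (hα : ∀ b ∈ F, 0 ≤ α b)
    (h : ∀ b ∈ F, HoldsWithProb P n (α b) (A b)) :
    HoldsWithProb P n (∑ b ∈ F, α b) fun D => ∀ b ∈ F, A b D := by
  calc Measure.pi (fun _ : Fin n => P) {D | ¬ ∀ b ∈ F, A b D}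
      ≤ Measure.pi (fun _ : Fin n => P) (⋃ b ∈ F, {D | ¬ A b D}) :=
        measure_mono fun D hD => by simpa using hD
    _ ≤ ∑ b ∈ F, Measure.pi (fun _ : Fin n => P) {D | ¬ A b D} := measure_biUnion_finset_le _ _
    _ ≤ ∑ b ∈ F, ENNReal.ofReal (α b) := Finset.sum_le_sum h
    _ = ENNReal.ofReal (∑ b ∈ F, α b) := (ENNReal.ofReal_sum_of_nonneg hα).symm

variable {g : Predictor 𝒳} {B : ℕ}

theorem nullSingletonClass_map_score
    (hg : P.map (fun z => (g.1 z.1 : ℝ)) ≪ (volume : Measure ℝ)) :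
    NullSingletonClass (P.map fun z => g.1 z.1) := by
  refine ⟨fun c => ?_⟩
  have hnull : P.map (fun z => (g.1 z.1 : ℝ)) {(c : ℝ)} = 0 := hg (measure_singleton _)
  rw [Measure.map_apply (measurable_score g).subtype_val (measurableSet_singleton _)] at hnull
  rw [Measure.map_apply (measurable_score g) (measurableSet_singleton _), ← hnull]
  simp only [Set.preimage, Set.mem_singleton_iff, Subtype.ext_iff]

variable [NullSingletonClass (P.map fun z => g.1 z.1)]

theorem preimage_binIndex_ae_eq_openBin {b : ℕ} (hb : b < B) (D : Dataset 𝒳 n) :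
    (fun z : 𝒳 × unitInterval => binIndex B (fun m => g.1 (D m).1) (g.1 z.1)) ⁻¹' {b} =ᵐ[P]
      openBin (fun z => g.1 z.1) (boundary n B b) (boundary n B (b + 1)) D := by
  have hfiber : (fun z : 𝒳 × unitInterval => binIndex B (fun m => g.1 (D m).1) (g.1 z.1)) ⁻¹' {b} =
      (fun z => g.1 z.1) ⁻¹' Set.Ico (orderStat (fun m => g.1 (D m).1) (boundary n B b))
        (orderStat (fun m => g.1 (D m).1) (boundary n B (b + 1))) :=
    Set.ext fun z => binIndex_eq_iff _ hb
  rw [hfiber, openBin, ← orderStat_eq_kthSmallest, ← orderStat_eq_kthSmallest]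
  exact ((measurable_score g).quasiMeasurePreserving P).preimage_ae_eq Ioo_ae_eq_Ico.symm

/-- The error `Π̂_{b+1} - E[Y | S_(A_b) < g(X) < S_(A_{b+1})]` of the estimate made in bin `b`,
counting bins from zero. -/
noncomputable def binError (P : Measure (𝒳 × unitInterval)) (g : Predictor 𝒳) (B : ℕ)
    (D : Dataset 𝒳 n) (b : ℕ) : ℝ :=
  biasEstimate B (fun m => g.1 (D m).1) (fun m => (D m).2) (b + 1) -
    ∫ z, (z.2 : ℝ) ∂P[|openBin (fun z => g.1 z.1) (boundary n B b) (boundary n B (b + 1)) D]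

variable [IsProbabilityMeasure P]

theorem holdsWithProb_abs_binError_le (hn : 2 * B ≤ n) {b : ℕ} (hb : b < B) {t : ℝ} (ht : 0 ≤ t) :
    HoldsWithProb P n (2 * Real.exp (-2 * ((n / B : ℕ) - 1) * t ^ 2)) fun D =>
      |binError P g B D b| ≤ t + 1 / (n / B : ℕ) := by
  have hdiv : 2 ≤ n / B := (Nat.le_div_iff_mul_le (by omega)).mpr hn
  have hstep := boundary_add_div_le n B b
  have hu : boundary n B (b + 1) ≤ n + 1 :=
    (boundary_mono n B hb).trans_eq (boundary_self n (by omega))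
  have hl : boundary n B b ≤ n + 1 := by omega
  have hgeneric := ae_injective_and_mem_Ioo (κ := Fin n) P (measurable_score g)
  have hdeviation := measure_lt_abs_binInterior_mean_sub_le (P := P) (κ := Fin n)
    (f := fun z => (z.2 : ℝ)) (measurable_score g) (by fun_prop) (fun z => z.2.2) ht
    (by omega : boundary n B b + 1 < boundary n B (b + 1))
    (hgeneric.mono fun D hD => card_binInterior hD.1 hD.2 hl hu)
  have hcount : (n / B : ℕ) - 1 ≤ ((boundary n B (b + 1) - boundary n B b - 1 : ℕ) : ℝ) := by
    rw [sub_le_iff_le_add]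
    exact_mod_cast (by omega : n / B ≤ boundary n B (b + 1) - boundary n B b - 1 + 1)
  refine (measure_mono_ae ?_).trans (hdeviation.trans ?_)
  · filter_upwards [hgeneric] with D hD hfail
    refine lt_of_not_ge fun hle => hfail ?_
    rw [← sum_orderedLabel_Ioo hD.1 hD.2 hl hu fun m => (D m).2] at hle
    have hboundary := abs_biasEstimate_sub_le (fun m => g.1 (D m).1) hb hn fun m => (D m).2
    exact (abs_sub_le _ _ _).trans ((add_le_add hboundary hle).trans_eq (add_comm _ _))
  · gcongr ENNReal.ofReal (2 * Real.exp ?_)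
    linarith [mul_le_mul_of_nonneg_right hcount (sq_nonneg t)]

theorem approxCalibrated_originalUMD_of_binError_le (hB : 1 ≤ B) {ε : ℝ} (hε : 0 ≤ ε)
    {D : Dataset 𝒳 n} (hD : ∀ b < B, |binError P g B D b| ≤ ε) :
    ApproxCalibrated P (originalUMD n B g D) ε := by
  let s : Fin n → unitInterval := fun m => g.1 (D m).1
  let G (b : ℕ) : unitInterval :=
    if b < B then ⟨_, biasEstimate_mem B s (fun m => (D m).2) (b + 1)⟩ else 0
  have hG (z : 𝒳 × unitInterval) :
      (originalUMD n B g D).1 z.1 = G (binIndex B s (g.1 z.1)) := by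
    refine Subtype.ext ((binnedScore_eq s (fun m => (D m).2) (g.1 z.1)).trans ?_)
    simp only [G, apply_ite Subtype.val, Set.Icc.coe_zero]
  refine approxCalibrated_of_comp ((measurable_binIndex s B).comp (measurable_score g)) hG hε ?_
  have hne_one : ∀ᵐ z ∂P, g.1 z.1 ≠ 1 :=
    ae_of_ae_map (measurable_score g).aemeasurable (Measure.ae_ne (P.map fun z => g.1 z.1) 1)
  filter_upwards [hne_one] with z hz
  have hbin : binIndex B s (g.1 z.1) < B :=
    binIndex_lt s hB (unitInterval.lt_one_iff_ne_one.mpr hz)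
  have hcell := integral_cond_congr_set
    (preimage_binIndex_ae_eq_openBin (P := P) (g := g) hbin D) fun z => (z.2 : ℝ)
  have hval : (G (binIndex B s (g.1 z.1)) : ℝ) =
      biasEstimate B s (fun m => (D m).2) (binIndex B s (g.1 z.1) + 1) := by
    simp only [G, if_pos hbin]
  rw [hG, hval, abs_sub_comm]
  exact hcell ▸ hD _ hbin

end Histogram

end HistogramBinning

open HistogramBinning in
theorem corollary1_general {𝒳 : Type*} [MeasurableSpace 𝒳] (n B : ℕ) (hB : 1 ≤ B) (hn : 2 * B ≤ n)
    (α : ℝ) (hα0 : 0 < α) (ε : ℝ)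
    (hε : ε = Real.sqrt (Real.log (2 * (B : ℝ) / α) / (2 * (((n / B : ℕ) : ℝ) - 1)))
      + 1 / ((n / B : ℕ) : ℝ))
    (g : Predictor 𝒳) (P : Measure (𝒳 × unitInterval)) [IsProbabilityMeasure P]
    [NullSingletonClass (P.map fun z => g.1 z.1)] :
    ConditionallyCalibratedAt (originalUMD n B) ε α g P ∧
      HoldsWithProb P n α (fun D => ∀ p : ℝ, 1 ≤ p → ece P (originalUMD n B g D) p ≤ ε) := by
  have hε0 : 0 ≤ ε := hε ▸ by positivity
  have hB0 : (0 : ℝ) < B := by exact_mod_cast hB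
  have hK : (0 : ℝ) < (n / B : ℕ) - 1 := by
    rw [sub_pos, Nat.one_lt_cast]
    exact (Nat.le_div_iff_mul_le hB).mpr hn
  have hδ : 0 < α / B := div_pos hα0 hB0
  have hbin (b : ℕ) (hb : b ∈ Finset.range B) :
      HoldsWithProb P n (α / B) fun D => |binError P g B D b| ≤ ε := by
    rw [hε, show 2 * (B : ℝ) / α = 2 / (α / B) by field_simp]
    exact (holdsWithProb_abs_binError_le hn (Finset.mem_range.mp hb) (Real.sqrt_nonneg _)).mono
      (two_mul_exp_neg_mul_sq_sqrt_le hK hδ) fun _ => id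
  have hall := holdsWithProb_forall_of_forall (fun _ _ => hδ.le) hbin
  rw [Finset.sum_const, Finset.card_range, nsmul_eq_mul, mul_div_cancel₀ _ hB0.ne'] at hall
  have hcal : ConditionallyCalibratedAt (originalUMD n B) ε α g P := hall.mono le_rfl fun D hD =>
    approxCalibrated_originalUMD_of_binError_le hB hε0 fun b hb => hD b (Finset.mem_range.mpr hb)
  exact ⟨hcal, hcal.mono le_rfl fun D hD p hp => hD.ece_le hε0 (one_pos.trans_le hp)⟩

open HistogramBinning in
theorem corollary1 {𝒳 : Type*} [MeasurableSpace 𝒳] (n B : ℕ) (hB : 1 ≤ B) (hn : 2 * B ≤ n)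
    (α : ℝ) (hα0 : 0 < α) (hα1 : α < 1) (ε : ℝ)
    (hε : ε = Real.sqrt (Real.log (2 * (B : ℝ) / α) / (2 * (((n / B : ℕ) : ℝ) - 1)))
      + 1 / ((n / B : ℕ) : ℝ))
    (g : Predictor 𝒳) (P : Measure (𝒳 × unitInterval)) [IsProbabilityMeasure P]
    (hg : P.map (fun z => (g.1 z.1 : ℝ)) ≪ (volume : Measure ℝ)) :
    ConditionallyCalibratedAt (originalUMD n B) ε α g P ∧
      HoldsWithProb P n α (fun D => ∀ p : ℝ, 1 ≤ p → ece P (originalUMD n B g D) p ≤ ε) := by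
  have := nullSingletonClass_map_score hg
  exact corollary1_general n B hB hn α hα0 ε hε g P
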